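/- Let $\mathcal C$ be a fusion category over $\mathbb C$ (a $\mathbb C$-linear rigid semisimple abelian monoidal category with $\mathbb C$-bilinear tensor product, finitely many simple objects up to isomorphism, finite-dimensional morphism spaces and simple unit object) whose simple objects are, up to isomorphism, exactly the six pairwise non-isomorphic objects $1$ (the unit), $\alpha$, $\alpha^*$, $\rho$, ${}_\alpha\rho$, ${}_{\alpha^*}\rho$, with the fusion rules of $\mathcal H_3$: $\{1,\alpha,\alpha^*\}\cong\mathbb Z/3$ under $\otimes$, $\alpha\otimes\rho\cong{}_\alpha\rho\cong\rho\otimes\alpha^*$, $\alpha^*\otimes\rho\cong{}_{\alpha^*}\rho\cong\rho\otimes\alpha$, and $\rho\otimes\rho\cong 1\oplus\rho\oplus{}_\alpha\rho\oplus{}_{\alpha^*}\rho$ (the remaining products follow by associativity). In particular $\mathcal C$ may be the fusion category $\mathcal H_3$ itself. All spaces $V_c^{ab}=\operatorname{Hom}(c,a\otimes b)$ between simple objects have dimension $N_c^{ab}\in\{0,1\}$; choose a basis vector $v_c^{ab}$ in each one that is non-zero. For simple $x,y,z,u$ let $F_u^{xyz}$ be the matrix of the linear map $\operatorname{Hom}(u,(x\otimes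 y)\otimes z)\to\operatorname{Hom}(u,x\otimes(y\otimes z))$ given by composition with the associator, with respect to the bases of trees: $$a_{x,y,z}\circ(v_k^{xy}\otimes\mathrm{id}_z)\circ v_u^{kz}=\sum_j (F_u^{xyz})_{jk}\,(\mathrm{id}_x\otimes v_j^{yz})\circ v_u^{xj}.$$ Let $l_\rho:\operatorname{Hom}(\rho,1\otimes\rho)\to\operatorname{Hom}(\rho,\rho)$ and $r_\rho:\operatorname{Hom}(\rho,\rho\otimes1)\to\operatorname{Hom}(\rho,\rho)$ be the maps given by composition with the left and right unit isomorphisms, and suppose that the basis vectors are normalised so that $l_\rho=r_\rho=1$ as numbers, i.e. $l_\rho(v_\rho^{1\rho})=\mathrm{id}_\rho=r_\rho(v_\rho^{\rho1})$. Then for every $x\in\{\rho,{}_\alpha\rho,{}_{\alpha^*}\rho\}$ the matrices $F_x^{\rho1\rho}$, $F_\rho^{1\rho x}$ and $F_\rho^{x\rho1}$ are $1\times1$ and $$F_x^{\rho1\rho}=F_\rho^{1\rho x}=F_\rho^{x\rho1}=1 .$$ -/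

import Mathlib

open CategoryTheory MonoidalCategory CategoryTheory.Limits

universe w w'

attribute [local instance] Abelian.hasFiniteBiproducts

/-- A `ℂ`-linear rigid abelian monoidal category (with `ℂ`-bilinear tensor product) is a fusion
category if it is semisimple, has finitely many simple objects up to isomorphism and
finite-dimensional morphism spaces, and its unit object is simple. -/
class IsFusionCategory (C : Type w) [Category.{w'} C] [Abelian C] [Linear ℂ C]
    [MonoidalCategory C] [MonoidalPreadditive C] [MonoidalLinear ℂ C] [RigidCategory C] :
    Prop where
  finite_hom : ∀ X Y : C, Module.Finite ℂ (X ⟶ Y)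
  semisimple : ∀ X : C, ∃ (n : ℕ) (f : Fin n → C),
    (∀ i, Simple (f i)) ∧ Nonempty (X ≅ ⨁ f)
  finite_simples : ∃ (n : ℕ) (s : Fin n → C), ∀ X : C, Simple X → ∃ i, Nonempty (X ≅ s i)
  simple_unit : Simple (𝟙_ C)

/-- The six labels `1, α, α*, ρ, _αρ, _{α*}ρ`. -/
inductive H3Label : Type
  | one
  | alpha
  | alphaStar
  | rho
  | alphaRho
  | alphaStarRho
  deriving DecidableEq

instance : Fintype H3Label where
  elems := {.one, .alpha, .alphaStar, .rho, .alphaRho, .alphaStarRho}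
  complete := by intro x; cases x <;> decide

namespace H3Label

/-- The fusion table: `fuse a b` is the set of simple summands (each of multiplicity one)
of `a ⊗ b`. -/
def fuse : H3Label → H3Label → Finset H3Label
  | one, b => {b}
  | a, one => {a}
  | alpha, alpha => {alphaStar}
  | alpha, alphaStar => {one}
  | alpha, rho => {alphaRho}
  | alpha, alphaRho => {alphaStarRho}
  | alpha, alphaStarRho => {rho}
  | alphaStar, alpha => {one}
  | alphaStar, alphaStar => {alpha}
  | alphaStar, rho => {alphaStarRho}
  | alphaStar, alphaRho => {rho}
  | alphaStar, alphaStarRho => {alphaRho}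
  | rho, alpha => {alphaStarRho}
  | rho, alphaStar => {alphaRho}
  | rho, rho => {one, rho, alphaRho, alphaStarRho}
  | rho, alphaRho => {alphaStar, rho, alphaRho, alphaStarRho}
  | rho, alphaStarRho => {alpha, rho, alphaRho, alphaStarRho}
  | alphaRho, alpha => {rho}
  | alphaRho, alphaStar => {alphaStarRho}
  | alphaRho, rho => {alpha, rho, alphaRho, alphaStarRho}
  | alphaRho, alphaRho => {one, rho, alphaRho, alphaStarRho}
  | alphaRho, alphaStarRho => {alphaStar, rho, alphaRho, alphaStarRho}
  | alphaStarRho, alpha => {alphaRho}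
  | alphaStarRho, alphaStar => {rho}
  | alphaStarRho, rho => {alphaStar, rho, alphaRho, alphaStarRho}
  | alphaStarRho, alphaRho => {alpha, rho, alphaRho, alphaStarRho}
  | alphaStarRho, alphaStarRho => {one, rho, alphaRho, alphaStarRho}

/-- The multiplicity `N_c^{ab}`. -/
def N (a b c : H3Label) : ℕ := if c ∈ fuse a b then 1 else 0

/-- The intermediate labels `k` of the trees `u → k ⊗ z → (x ⊗ y) ⊗ z`. -/
def leftChannels (x y z u : H3Label) : Finset H3Label :=
  Finset.univ.filter fun k => k ∈ fuse x y ∧ u ∈ fuse k z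

/-- The intermediate labels `j` of the trees `u → x ⊗ j → x ⊗ (y ⊗ z)`. -/
def rightChannels (x y z u : H3Label) : Finset H3Label :=
  Finset.univ.filter fun j => j ∈ fuse y z ∧ u ∈ fuse x j

end H3Label

open H3Label

/-- A choice of objects for the five labels other than `1`. -/
structure H3Objects (C : Type w) where
  alpha : C
  alphaStar : C
  rho : C
  alphaRho : C
  alphaStarRho : C

/-- The object with a given label; the label `1` is the unit object. -/
def H3Objects.obj {C : Type w} [Category.{w'} C] [MonoidalCategory C] (S : H3Objects C) :
    H3Label → C
  | .one => 𝟙_ C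
  | .alpha => S.alpha
  | .alphaStar => S.alphaStar
  | .rho => S.rho
  | .alphaRho => S.alphaRho
  | .alphaStarRho => S.alphaStarRho

section H3

variable {C : Type w} [Category.{w'} C] [Abelian C] [Linear ℂ C]
    [MonoidalCategory C] [MonoidalPreadditive C] [MonoidalLinear ℂ C] [RigidCategory C]

/-- The category has exactly the six simple objects `1, α, α*, ρ, _αρ, _{α*}ρ` up to isomorphism,
and `dim Hom(c, a ⊗ b) = N_c^{ab}` is given by the fusion table of `H_3`. -/
structure H3Objects.HasH3FusionRules (S : H3Objects C) : Prop where
  simple : ∀ a, Simple (S.obj a)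
  eq_of_iso : ∀ a b, Nonempty (S.obj a ≅ S.obj b) → a = b
  exhaustive : ∀ X : C, Simple X → ∃ a, Nonempty (X ≅ S.obj a)
  fusion : ∀ a b c, Module.finrank ℂ (S.obj c ⟶ S.obj a ⊗ S.obj b) = N a b c

/-- A choice of a basis vector in each of the (at most one-dimensional) spaces
`V_c^{ab} = Hom(c, a ⊗ b)`; the vector is zero exactly if the space is zero. -/
structure H3Objects.VertexBasis (S : H3Objects C) where
  vec : ∀ a b c : H3Label, S.obj c ⟶ S.obj a ⊗ S.obj b
  vec_ne_zero : ∀ a b c, c ∈ fuse a b → vec a b c ≠ 0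

namespace H3Objects

variable {S : H3Objects C}

/-- The tree `u → k ⊗ z → (x ⊗ y) ⊗ z`. -/
def leftTree (b : S.VertexBasis) (x y z u k : H3Label) :
    S.obj u ⟶ (S.obj x ⊗ S.obj y) ⊗ S.obj z :=
  b.vec k z u ≫ b.vec x y k ▷ S.obj z

/-- The tree `u → x ⊗ j → x ⊗ (y ⊗ z)`. -/
def rightTree (b : S.VertexBasis) (x y z u j : H3Label) :
    S.obj u ⟶ S.obj x ⊗ (S.obj y ⊗ S.obj z) :=
  b.vec x j u ≫ S.obj x ◁ b.vec y z j

theorem vec_eq_zero [IsFusionCategory C] (hS : S.HasH3FusionRules) (b : S.VertexBasis) {x y c : H3Label}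
    (h : c ∉ fuse x y) : b.vec x y c = 0 := by
  have := IsFusionCategory.finite_hom (S.obj c) (S.obj x ⊗ S.obj y)
  have hf := hS.fusion x y c
  rw [N, if_neg h] at hf
  have := Module.finrank_zero_iff.1 hf
  exact Subsingleton.elim _ _

theorem exists_smul_vec [IsFusionCategory C] (hS : S.HasH3FusionRules) (b : S.VertexBasis) (x y c : H3Label)
    (g : S.obj c ⟶ S.obj x ⊗ S.obj y) : ∃ t : ℂ, t • b.vec x y c = g := by
  have := IsFusionCategory.finite_hom (S.obj c) (S.obj x ⊗ S.obj y)
  have hf := hS.fusion x y c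
  by_cases h : c ∈ fuse x y
  · rw [N, if_pos h] at hf
    exact (finrank_eq_one_iff_of_nonzero' _ (b.vec_ne_zero x y c h)).1 hf g
  · rw [N, if_neg h] at hf
    have := Module.finrank_zero_iff.1 hf
    exact ⟨0, Subsingleton.elim _ _⟩

theorem exists_split [IsFusionCategory C] (hS : S.HasH3FusionRules) (b : S.VertexBasis) (x y : H3Label) :
    ∃ q : ∀ j, S.obj x ⊗ S.obj y ⟶ S.obj j,
      𝟙 (S.obj x ⊗ S.obj y) = ∑ j, q j ≫ b.vec x y j ∧
      (∀ j ∈ fuse x y, b.vec x y j ≫ q j = 𝟙 _) ∧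
      ∀ i j, i ≠ j → b.vec x y i ≫ q j = 0 := by
  have key : ∀ (n : ℕ) (g : Fin n → (S.obj x ⊗ S.obj y ⟶ S.obj x ⊗ S.obj y)),
      (∀ i, ∃ (c : H3Label) (p : S.obj x ⊗ S.obj y ⟶ S.obj c), g i = p ≫ b.vec x y c) →
      ∃ q : ∀ j, S.obj x ⊗ S.obj y ⟶ S.obj j, ∑ i, g i = ∑ j, q j ≫ b.vec x y j := by
    intro n g hg
    choose c p hp using hg
    refine ⟨fun j => ∑ i, if h : c i = j then p i ≫ eqToHom (by rw [h]) else 0, ?_⟩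
    simp_rw [Preadditive.sum_comp]
    rw [Finset.sum_comm]
    refine Finset.sum_congr rfl fun i _ => ?_
    rw [Finset.sum_eq_single (c i)]
    · simp [hp]
    · intro j _ hj
      simp [Ne.symm hj]
    · simp
  obtain ⟨n, f, hf, ⟨e⟩⟩ := IsFusionCategory.semisimple (S.obj x ⊗ S.obj y)
  obtain ⟨q, hq⟩ := key n (fun i => e.hom ≫ biproduct.π f i ≫ biproduct.ι f i ≫ e.inv) (by
    intro i
    obtain ⟨c, ⟨d⟩⟩ := hS.exhaustive (f i) (hf i)
    obtain ⟨t, ht⟩ := exists_smul_vec hS b x y c (d.inv ≫ biproduct.ι f i ≫ e.inv)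
    refine ⟨c, t • (e.hom ≫ biproduct.π f i ≫ d.hom), ?_⟩
    rw [Linear.smul_comp, ← Linear.comp_smul, ht]
    simp)
  have hid : 𝟙 (S.obj x ⊗ S.obj y) = ∑ j, q j ≫ b.vec x y j := by
    rw [← hq, ← Preadditive.comp_sum]
    have h1 : ∑ i, biproduct.π f i ≫ biproduct.ι f i ≫ e.inv = e.inv := by
      simp_rw [← Category.assoc]
      rw [← Preadditive.sum_comp, biproduct.total, Category.id_comp]
    rw [h1, e.hom_inv_id]
  have hne : ∀ i j, i ≠ j → b.vec x y i ≫ q j = 0 := by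
    intro i j hij
    have := hS.simple i
    have := hS.simple j
    by_contra h
    have := isIso_of_hom_simple h
    exact hij (hS.eq_of_iso i j ⟨asIso (b.vec x y i ≫ q j)⟩)
  refine ⟨q, hid, ?_, hne⟩
  intro j hj
  have := hS.simple j
  have := IsFusionCategory.finite_hom (S.obj j) (S.obj j)
  obtain ⟨t, ht⟩ := endomorphism_simple_eq_smul_id ℂ (b.vec x y j ≫ q j)
  have h1 : b.vec x y j = t • b.vec x y j := by
    conv_lhs => rw [← Category.comp_id (b.vec x y j), hid, Preadditive.comp_sum]
    rw [Finset.sum_eq_single j]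
    · rw [← Category.assoc, ← ht, Linear.smul_comp, Category.id_comp]
    · intro i _ hi
      rw [← Category.assoc, hne j i (Ne.symm hi), zero_comp]
    · simp
  have h2 : t = 1 := by
    have h3 : (t - 1) • b.vec x y j = 0 := by
      rw [sub_smul, one_smul, ← h1, sub_self]
    rcases smul_eq_zero.1 h3 with h | h
    · exact sub_eq_zero.1 h
    · exact absurd h (b.vec_ne_zero x y j hj)
  rw [← ht, h2, one_smul]

theorem leftTree_linearIndependent [IsFusionCategory C] (hS : S.HasH3FusionRules) (b : S.VertexBasis)
    (x y z u : H3Label) :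
    LinearIndependent ℂ fun k : leftChannels x y z u => leftTree b x y z u k := by
  obtain ⟨q, -, h1, h0⟩ := exists_split hS b x y
  rw [Fintype.linearIndependent_iff]
  intro m hm k
  have hk := (Finset.mem_filter.1 k.2).2
  have h := congrArg (fun g => g ≫ (q k ▷ S.obj z)) hm
  simp only [Preadditive.sum_comp, zero_comp, Linear.smul_comp, leftTree, Category.assoc,
    ← comp_whiskerRight] at h
  rw [Finset.sum_eq_single k] at h
  · rw [h1 _ hk.1, id_whiskerRight, Category.comp_id] at h
    exact (smul_eq_zero.1 h).resolve_right (b.vec_ne_zero _ _ _ hk.2)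
  · intro i _ hi
    rw [h0 _ _ fun h => hi (Subtype.ext h), MonoidalPreadditive.zero_whiskerRight, comp_zero,
      smul_zero]
  · simp

theorem leftTree_span [IsFusionCategory C] (hS : S.HasH3FusionRules) (b : S.VertexBasis)
    (x y z u : H3Label) :
    ⊤ ≤ Submodule.span ℂ
      (Set.range fun k : leftChannels x y z u => leftTree b x y z u k) := by
  obtain ⟨q, hid, -, -⟩ := exists_split hS b x y
  intro g _
  have hg : g = ∑ k, (g ≫ q k ▷ S.obj z) ≫ b.vec x y k ▷ S.obj z := by
    conv_lhs => rw [← Category.comp_id g, ← id_whiskerRight, hid]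
    rw [sum_whiskerRight, Preadditive.comp_sum]
    simp
  rw [hg]
  refine Submodule.sum_mem _ fun k _ => ?_
  obtain ⟨t, ht⟩ := exists_smul_vec hS b k z u (g ≫ q k ▷ S.obj z)
  rw [← ht, Linear.smul_comp]
  refine Submodule.smul_mem _ _ ?_
  by_cases h : k ∈ leftChannels x y z u
  · exact Submodule.subset_span ⟨⟨k, h⟩, rfl⟩
  · have h' : ¬ (k ∈ fuse x y ∧ u ∈ fuse k z) := fun h'' =>
      h (Finset.mem_filter.2 ⟨Finset.mem_univ _, h''⟩)
    rcases not_and_or.1 h' with h' | h'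
    · rw [vec_eq_zero hS b h', MonoidalPreadditive.zero_whiskerRight, comp_zero]
      exact Submodule.zero_mem _
    · rw [vec_eq_zero hS b h', zero_comp]
      exact Submodule.zero_mem _

theorem rightTree_linearIndependent [IsFusionCategory C] (hS : S.HasH3FusionRules) (b : S.VertexBasis)
    (x y z u : H3Label) :
    LinearIndependent ℂ fun j : rightChannels x y z u => rightTree b x y z u j := by
  obtain ⟨q, -, h1, h0⟩ := exists_split hS b y z
  rw [Fintype.linearIndependent_iff]
  intro m hm k
  have hk := (Finset.mem_filter.1 k.2).2
  have h := congrArg (fun g => g ≫ (S.obj x ◁ q k)) hm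
  simp only [Preadditive.sum_comp, zero_comp, Linear.smul_comp, rightTree, Category.assoc,
    ← whiskerLeft_comp] at h
  rw [Finset.sum_eq_single k] at h
  · rw [h1 _ hk.1, whiskerLeft_id, Category.comp_id] at h
    exact (smul_eq_zero.1 h).resolve_right (b.vec_ne_zero _ _ _ hk.2)
  · intro i _ hi
    rw [h0 _ _ fun h => hi (Subtype.ext h), MonoidalPreadditive.whiskerLeft_zero, comp_zero,
      smul_zero]
  · simp

theorem rightTree_span [IsFusionCategory C] (hS : S.HasH3FusionRules) (b : S.VertexBasis)
    (x y z u : H3Label) :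
    ⊤ ≤ Submodule.span ℂ
      (Set.range fun j : rightChannels x y z u => rightTree b x y z u j) := by
  obtain ⟨q, hid, -, -⟩ := exists_split hS b y z
  intro g _
  have hg : g = ∑ k, (g ≫ S.obj x ◁ q k) ≫ S.obj x ◁ b.vec y z k := by
    conv_lhs => rw [← Category.comp_id g, ← whiskerLeft_id, hid]
    rw [whiskerLeft_sum, Preadditive.comp_sum]
    simp
  rw [hg]
  refine Submodule.sum_mem _ fun k _ => ?_
  obtain ⟨t, ht⟩ := exists_smul_vec hS b x k u (g ≫ S.obj x ◁ q k)
  rw [← ht, Linear.smul_comp]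
  refine Submodule.smul_mem _ _ ?_
  by_cases h : k ∈ rightChannels x y z u
  · exact Submodule.subset_span ⟨⟨k, h⟩, rfl⟩
  · have h' : ¬ (k ∈ fuse y z ∧ u ∈ fuse x k) := fun h'' =>
      h (Finset.mem_filter.2 ⟨Finset.mem_univ _, h''⟩)
    rcases not_and_or.1 h' with h' | h'
    · rw [vec_eq_zero hS b h', MonoidalPreadditive.whiskerLeft_zero, comp_zero]
      exact Submodule.zero_mem _
    · rw [vec_eq_zero hS b h', zero_comp]
      exact Submodule.zero_mem _

/-- The basis of `Hom(u, (x ⊗ y) ⊗ z)` consisting of the left trees. -/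
noncomputable def leftBasis [IsFusionCategory C] (hS : S.HasH3FusionRules) (b : S.VertexBasis)
    (x y z u : H3Label) :
    Module.Basis (leftChannels x y z u) ℂ (S.obj u ⟶ (S.obj x ⊗ S.obj y) ⊗ S.obj z) :=
  Module.Basis.mk (leftTree_linearIndependent hS b x y z u) (leftTree_span hS b x y z u)

/-- The basis of `Hom(u, x ⊗ (y ⊗ z))` consisting of the right trees. -/
noncomputable def rightBasis [IsFusionCategory C] (hS : S.HasH3FusionRules) (b : S.VertexBasis)
    (x y z u : H3Label) :
    Module.Basis (rightChannels x y z u) ℂ (S.obj u ⟶ S.obj x ⊗ (S.obj y ⊗ S.obj z)) :=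
  Module.Basis.mk (rightTree_linearIndependent hS b x y z u) (rightTree_span hS b x y z u)

/-- The matrix `F_u^{xyz}` of the linear map
`Hom(u, (x ⊗ y) ⊗ z) → Hom(u, x ⊗ (y ⊗ z))` given by the associator, in the bases of trees:
`leftTree k ↦ ∑ j, (F_u^{xyz})_{jk} • rightTree j`. -/
noncomputable def Fmat [IsFusionCategory C] (hS : S.HasH3FusionRules) (b : S.VertexBasis)
    (x y z u : H3Label) :
    Matrix (rightChannels x y z u) (leftChannels x y z u) ℂ :=
  LinearMap.toMatrix (leftBasis hS b x y z u) (rightBasis hS b x y z u)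
    (Linear.rightComp ℂ (S.obj u) (α_ (S.obj x) (S.obj y) (S.obj z)).hom)

/-- The map `l_x : Hom(x, 1 ⊗ x) → Hom(x, x)` induced by the left unitor. -/
noncomputable def leftUnit (S : H3Objects C) (x : H3Label) :
    (S.obj x ⟶ S.obj .one ⊗ S.obj x) →ₗ[ℂ] (S.obj x ⟶ S.obj x) :=
  Linear.rightComp ℂ (S.obj x) (λ_ (S.obj x)).hom

/-- The map `r_x : Hom(x, x ⊗ 1) → Hom(x, x)` induced by the right unitor. -/
noncomputable def rightUnit (S : H3Objects C) (x : H3Label) :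
    (S.obj x ⟶ S.obj x ⊗ S.obj .one) →ₗ[ℂ] (S.obj x ⟶ S.obj x) :=
  Linear.rightComp ℂ (S.obj x) (ρ_ (S.obj x)).hom

end H3Objects

end H3

/-- A matrix is the `1 × 1` matrix with entry `c`. -/
def Matrix.IsScalarOneByOne {m n : Type} [Fintype m] [Fintype n] (M : Matrix m n ℂ) (c : ℂ) :
    Prop :=
  Fintype.card m = 1 ∧ Fintype.card n = 1 ∧ ∀ i j, M i j = c

/-! When one of the three tensor factors is the unit, each tree consists of one vertex of $V_c^{ab}$
and one unit vertex. The normalisation $l_\rho=r_\rho=1$ says precisely that the unit vertices at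
$\rho$ are the inverse unitors. Coherence then moves the unit vertex across the associator and
leaves the other vertex untouched: the left tree goes to the right tree with coefficient 1, whatever
the scale of that other vertex. The position of the unit decides which identity is used: the
triangle axiom (`leftTree_one_middle`), or the unitor of a tensor product combined with naturality
(`leftTree_one_left`, `leftTree_one_right`). The fusion table leaves a single tree on each side, so
this coefficient is the whole matrix (`Fmat_isScalarOneByOne_one`). -/

section

variable {C : Type w} [Category.{w'} C] [Abelian C] [Linear ℂ C]
    [MonoidalCategory C] {S : H3Objects C}

namespace H3Objects

/-- A vertex normalised by `l_x = 1` is the inverse left unitor. -/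
theorem vec_one_left_eq {b : S.VertexBasis} {x : H3Label}
    (hl : S.leftUnit x (b.vec .one x x) = 𝟙 (S.obj x)) :
    b.vec .one x x = (λ_ (S.obj x)).inv :=
  (Iso.comp_hom_eq_id (λ_ (S.obj x))).1 hl

/-- A vertex normalised by `r_x = 1` is the inverse right unitor. -/
theorem vec_one_right_eq {b : S.VertexBasis} {x : H3Label}
    (hr : S.rightUnit x (b.vec x .one x) = 𝟙 (S.obj x)) :
    b.vec x .one x = (ρ_ (S.obj x)).inv :=
  (Iso.comp_hom_eq_id (ρ_ (S.obj x))).1 hr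

/-- The triangle axiom, in inverse form, precomposed with the common vertex `b.vec x z u`. -/
theorem leftTree_one_middle {b : S.VertexBasis} {x z : H3Label} (u : H3Label)
    (hr : S.rightUnit x (b.vec x .one x) = 𝟙 (S.obj x))
    (hl : S.leftUnit z (b.vec .one z z) = 𝟙 (S.obj z)) :
    leftTree b x .one z u x ≫ (α_ (S.obj x) (S.obj .one) (S.obj z)).hom =
      rightTree b x .one z u z := by
  rw [leftTree, rightTree, vec_one_right_eq hr, vec_one_left_eq hl]
  -- `S.obj .one` is `𝟙_ C` only after unfolding, so the terms are matched up to definitional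
  -- equality.
  refine (Category.assoc _ _ _).trans ?_
  exact congrArg (b.vec x z u ≫ ·) (triangle_assoc_comp_right_inv (S.obj x) (S.obj z))

/-- Naturality of $\lambda^{-1}$ slides the unit vertex from $u$ past `b.vec y z u`, and
$\lambda_{y\otimes z}^{-1}$ is $\lambda_y^{-1}\otimes\mathrm{id}_z$ followed by the associator. Only
$y$ and $u$ need normalised vertices, so $z$ is free. -/
theorem leftTree_one_left {b : S.VertexBasis} {y u : H3Label} (z : H3Label)
    (hy : S.leftUnit y (b.vec .one y y) = 𝟙 (S.obj y))
    (hu : S.leftUnit u (b.vec .one u u) = 𝟙 (S.obj u)) :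
    leftTree b .one y z u y ≫ (α_ (S.obj .one) (S.obj y) (S.obj z)).hom =
      rightTree b .one y z u u := by
  rw [leftTree, rightTree, vec_one_left_eq hy, vec_one_left_eq hu]
  change (b.vec y z u ≫ (λ_ (S.obj y)).inv ▷ S.obj z) ≫ (α_ (𝟙_ C) (S.obj y) (S.obj z)).hom =
    (λ_ (S.obj u)).inv ≫ 𝟙_ C ◁ b.vec y z u
  rw [← leftUnitor_inv_naturality, leftUnitor_tensor_inv, Category.assoc]

/-- Mirror image, with $\rho_{x\otimes y}^{-1}$ ending in the inverse associator, which cancels. -/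
theorem leftTree_one_right {b : S.VertexBasis} {y u : H3Label} (x : H3Label)
    (hy : S.rightUnit y (b.vec y .one y) = 𝟙 (S.obj y))
    (hu : S.rightUnit u (b.vec u .one u) = 𝟙 (S.obj u)) :
    leftTree b x y .one u u ≫ (α_ (S.obj x) (S.obj y) (S.obj .one)).hom =
      rightTree b x y .one u y := by
  rw [leftTree, rightTree, vec_one_right_eq hy, vec_one_right_eq hu]
  change ((ρ_ (S.obj u)).inv ≫ b.vec x y u ▷ 𝟙_ C) ≫ (α_ (S.obj x) (S.obj y) (𝟙_ C)).hom =
    b.vec x y u ≫ S.obj x ◁ (ρ_ (S.obj y)).inv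
  rw [← rightUnitor_inv_naturality, rightUnitor_tensor_inv, Category.assoc, Category.assoc, Iso.inv_hom_id,
    Category.comp_id]

variable [MonoidalPreadditive C] [MonoidalLinear ℂ C] [RigidCategory C] [IsFusionCategory C]

/-- If the associator carries the only left tree to the only right tree, then the matrix
`F_u^{xyz}` is the `1 × 1` identity matrix. -/
theorem Fmat_isScalarOneByOne_one (hS : S.HasH3FusionRules) (b : S.VertexBasis)
    {x y z u k j : H3Label} (hk : leftChannels x y z u = {k}) (hj : rightChannels x y z u = {j})
    (h : leftTree b x y z u k ≫ (α_ (S.obj x) (S.obj y) (S.obj z)).hom =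
      rightTree b x y z u j) :
    (Fmat hS b x y z u).IsScalarOneByOne 1 := by
  refine ⟨by simp [hj], by simp [hk], ?_⟩
  rintro ⟨i, hi⟩ ⟨l, hl⟩
  obtain rfl : i = j := by simpa [hj] using hi
  obtain rfl : l = k := by simpa [hk] using hl
  have hL : leftBasis hS b x y z u ⟨l, hl⟩ = leftTree b x y z u l := by simp [leftBasis]
  have hR : rightBasis hS b x y z u ⟨i, hi⟩ = rightTree b x y z u i := by simp [rightBasis]
  -- The entry is the coordinate of a basis vector along itself.
  rw [Fmat, LinearMap.toMatrix_apply, hL, Linear.rightComp_apply, h, ← hR, Module.Basis.repr_self,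
    Finsupp.single_eq_same]

end H3Objects

end

theorem mainTheorem6 {C : Type w} [Category.{w'} C] [Abelian C] [Linear ℂ C]
    [MonoidalCategory C] [MonoidalPreadditive C] [MonoidalLinear ℂ C] [RigidCategory C]
    [IsFusionCategory C] (S : H3Objects C) (hS : S.HasH3FusionRules) (b : S.VertexBasis)
    (hl : S.leftUnit .rho (b.vec .one .rho .rho) = 𝟙 (S.obj .rho))
    (hr : S.rightUnit .rho (b.vec .rho .one .rho) = 𝟙 (S.obj .rho))
    (x : H3Label) (hx : x = .rho ∨ x = .alphaRho ∨ x = .alphaStarRho) :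
    (H3Objects.Fmat hS b .rho .one .rho x).IsScalarOneByOne 1 ∧
    (H3Objects.Fmat hS b .one .rho x .rho).IsScalarOneByOne 1 ∧
    (H3Objects.Fmat hS b x .rho .one .rho).IsScalarOneByOne 1 := by
  refine ⟨H3Objects.Fmat_isScalarOneByOne_one hS b (k := .rho) (j := .rho) ?_ ?_
      (H3Objects.leftTree_one_middle x hr hl),
    H3Objects.Fmat_isScalarOneByOne_one hS b (k := .rho) (j := .rho) ?_ ?_
      (H3Objects.leftTree_one_left x hl hl),
    H3Objects.Fmat_isScalarOneByOne_one hS b (k := .rho) (j := .rho) ?_ ?_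
      (H3Objects.leftTree_one_right x hr hr)⟩ <;>
  -- The remaining goals say that $\rho$ is the only channel on either side; for each $x$ this is
  -- read off the fusion table.
  rcases hx with rfl | rfl | rfl <;> decide
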